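/- Let $\Bbbk$ be a field; all algebras are associative unital $\Bbbk$-algebras. For an algebra $A$ write $A[t_1,\dots,t_n]$ for the polynomial extension of $A$ by $n$ commuting variables that commute with $A$, $M(A)$ for the category of all right $A$-modules, and, for a commutative algebra $Z$, $N(Z)$ for its nilradical. An algebra $A$ is called *strongly cancellative* if for every $n\ge 1$ and every algebra $B$, the existence of an isomorphism of $\Bbbk$-algebras $A[s_1,\dots,s_n]\cong B[t_1,\dots,t_n]$ implies $A\cong B$ as $\Bbbk$-algebras. It is called *strongly Morita cancellative* if for every $n\ge 1$ and every algebra $B$, the existence of an equivalence of abelian categories $M(A[s_1,\dots,s_n])\simeq M(B[t_1,\dots,t_n])$ implies the existence of an equivalence of abelian categories $M(A)\simeq M(B)$. A commutative algebra is *von Neumann regular* if it is reduced and of Krull dimension zero (the zero algebra included). **Corollary 0.6.** Let $A$ be an algebra with center $Z$. Suppose that at least one of the following holds: 1. $Z/N(Z)$ is generated, as a $\Bbbk$-algebra, by a set of units of $Z/N(Z)$; 2. $Z/N(Z)$ is von Neumann regular; 3. $Z$ is a finite direct sum (with componentwise operations) of local algebras. Then both $Z$ and $A$ are strongly cancellative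 and strongly Morita cancellative. Strong Morita cancellation holds in both readings of the definition: with arbitrary equivalences of categories in the hypothesis and the conclusion, and with $\Bbbk$-linear equivalences in the hypothesis and the conclusion. -/

import Mathlib

universe u v

/-- The polynomial extension `A[t₁, …, tₙ]` of a (not necessarily commutative) ring `A` by `n`
commuting variables, which also commute with the elements of `A`. For commutative `A` this is by
definition Mathlib's `MvPolynomial (Fin n) A`. -/
abbrev PolyExt (A : Type u) [Ring A] (n : ℕ) : Type u :=
  AddMonoidAlgebra A (Fin n →₀ ℕ)

/-- The category `M(A)` of all right `A`-modules. -/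
abbrev RightMod (A : Type u) [Ring A] : Type (u + 1) :=
  ModuleCat.{u} Aᵐᵒᵖ

/-- `M(A)` and `M(B)` are equivalent. (An equivalence between these abelian categories is
automatically additive and exact.) -/
def RightModEquivalent (A B : Type u) [Ring A] [Ring B] : Prop :=
  Nonempty (CategoryTheory.Equivalence (RightMod A) (RightMod B))

/-- `M(A)` and `M(B)` are equivalent through a `k`-linear equivalence. -/
def RightModLinearEquivalent (k : Type v) [Field k] (A B : Type u) [Ring A] [Ring B]
    [Algebra k A] [Algebra k B] : Prop :=
  IsMoritaEquivalent k Aᵐᵒᵖ Bᵐᵒᵖ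

/-- `A` is strongly cancellative: for all `n ≥ 1` and all `k`-algebras `B`, if
`A[s₁, …, sₙ] ≅ B[t₁, …, tₙ]` as `k`-algebras, then `A ≅ B` as `k`-algebras. -/
def StronglyCancellative (k : Type v) [Field k] (A : Type u) [Ring A] [Algebra k A] : Prop :=
  ∀ (n : ℕ), 1 ≤ n → ∀ (B : Type u) [Ring B] [Algebra k B],
    Nonempty (PolyExt A n ≃ₐ[k] PolyExt B n) → Nonempty (A ≃ₐ[k] B)

/-- `A` is strongly Morita cancellative: for all `n ≥ 1` and all `k`-algebras `B`, if the
categories `M(A[s₁, …, sₙ])` and `M(B[t₁, …, tₙ])` are equivalent, then so are `M(A)` and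
`M(B)`. -/
def StronglyMoritaCancellative (k : Type v) [Field k] (A : Type u) [Ring A] [Algebra k A] :
    Prop :=
  ∀ (n : ℕ), 1 ≤ n → ∀ (B : Type u) [Ring B] [Algebra k B],
    RightModEquivalent (PolyExt A n) (PolyExt B n) → RightModEquivalent A B

/-- Strong Morita cancellation where all equivalences of module categories are `k`-linear. -/
def StronglyLinearMoritaCancellative (k : Type v) [Field k] (A : Type u) [Ring A]
    [Algebra k A] : Prop :=
  ∀ (n : ℕ), 1 ≤ n → ∀ (B : Type u) [Ring B] [Algebra k B],
    RightModLinearEquivalent k (PolyExt A n) (PolyExt B n) → RightModLinearEquivalent k A B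

/-- The `k`-algebra `R` is generated by a set of units of `R`. -/
def GeneratedByUnits (k : Type v) [Field k] (R : Type u) [CommRing R] [Algebra k R] : Prop :=
  ∃ S : Set R, (∀ x ∈ S, IsUnit x) ∧ Algebra.adjoin k S = ⊤

/-- A commutative ring is von Neumann regular if it is reduced of Krull dimension zero (the zero
ring, whose spectrum is empty, is included). -/
def IsVonNeumannRegular (R : Type u) [CommRing R] : Prop :=
  IsReduced R ∧ Ring.KrullDimLE 0 R

/-- The commutative `k`-algebra `R` is a finite direct sum, with componentwise operations, of
local `k`-algebras. -/
def IsFiniteSumOfLocalAlgebras (k : Type v) [Field k] (R : Type u) [CommRing R] [Algebra k R] :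
    Prop :=
  ∃ (m : ℕ) (L : Fin m → Type u) (_ : ∀ i, CommRing (L i)) (_ : ∀ i, Algebra k (L i)),
    (∀ i, IsLocalRing (L i)) ∧ Nonempty (R ≃ₐ[k] (∀ i, L i))

open MvPolynomial CategoryTheory
open scoped ModuleCat.Algebra

/-! Each of the three hypotheses makes the center `R` of `A` generated by units and by elements
idempotent modulo nilpotents. In a polynomial ring over a commutative ring `S`, such elements are
constants up to nilpotents. So under any ring isomorphism `φ : R[X] ≃ S[X]` the images of constants
are constants up to nilpotents, and `S[X]` is generated over `S`, modulo nilpotents, by the `y i = φ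
(X i)`. A Nakayama argument removes the nilpotents, and a surjective `S`-endomorphism of `S[X]` is
injective, so the `y i` are a coordinate system (`bijective_aeval_of_ringEquiv`). Nothing is assumed
on `S`.

Take `S` to be the center of `B`. An algebra isomorphism or an equivalence of module categories
between `A[X]` and `B[X]` induces an isomorphism of centers, which are `R[X]` and `S[X]`. Then `A =
A[X]/(X)` corresponds to `B[X]/(y)`, and this quotient is `B` because the `y i` are coordinates. In
the Morita case, the modules killed by the `X i` correspond to those killed by the `y i`. -/

/-- A commutative ring is generated, as a ring, by its units and by the elements that are idempotent
modulo the nilradical. -/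
def GeneratedByUnitsAndIdempotents (R : Type*) [CommRing R] : Prop :=
  Subring.closure {x : R | IsUnit x ∨ IsNilpotent (x * x - x)} = ⊤

/-! ### Isomorphisms of commutative polynomial rings and coordinate systems. -/

section Commutative

variable {R S : Type*} [CommRing R] [CommRing S] {n : ℕ}

/-- Modulo a prime of `S` the polynomial ring is a domain, whose only idempotents are 0 and 1; hence
the higher coefficients of an idempotent modulo nilpotents lie in every prime. -/
theorem isNilpotent_sub_C_coeff_zero {y : MvPolynomial (Fin n) S}
    (hy : IsUnit y ∨ IsNilpotent (y * y - y)) : IsNilpotent (y - C (coeff 0 y)) := by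
  classical
  rw [MvPolynomial.isNilpotent_iff]
  intro m
  by_cases hm : m = 0
  · subst hm; simp
  rw [coeff_sub, coeff_C, if_neg (Ne.symm hm), sub_zero]
  rcases hy with hy | hy
  · exact (MvPolynomial.isUnit_iff.1 hy).2 m hm
  · rw [nilpotent_iff_mem_prime]
    intro p hp
    have h := (hy.map (MvPolynomial.map (Ideal.Quotient.mk p))).eq_zero
    rw [map_sub, map_mul, sub_eq_zero] at h
    rw [← Ideal.Quotient.eq_zero_iff_mem, ← MvPolynomial.coeff_map]
    rcases IsIdempotentElem.iff_eq_zero_or_one.1 h with h | h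
    · rw [h, coeff_zero]
    · rw [h, coeff_one, if_neg (Ne.symm hm)]

/-- The `r` with this property form a subring containing the generators. -/
theorem exists_isNilpotent_sub_C (hR : GeneratedByUnitsAndIdempotents R)
    (φ : MvPolynomial (Fin n) R ≃+* MvPolynomial (Fin n) S) (r : R) :
    ∃ s, IsNilpotent (φ (C r) - C s) := by
  have hr : r ∈ Subring.closure {x : R | IsUnit x ∨ IsNilpotent (x * x - x)} := by
    rw [show Subring.closure {x : R | IsUnit x ∨ IsNilpotent (x * x - x)} = ⊤ from hR]
    trivial
  induction hr using Subring.closure_induction with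
  | mem x hx =>
    refine ⟨_, isNilpotent_sub_C_coeff_zero ?_⟩
    rcases hx with hx | hx
    · exact Or.inl ((hx.map C).map φ)
    · right
      simpa using (hx.map (C (σ := Fin n))).map φ
  | zero => exact ⟨0, by simp⟩
  | one => exact ⟨1, by simp⟩
  | add x y _ _ hx hy =>
    obtain ⟨s, hs⟩ := hx
    obtain ⟨t, ht⟩ := hy
    refine ⟨s + t, ?_⟩
    have := (Commute.all _ _).isNilpotent_add hs ht
    convert this using 1
    simp only [map_add]; ring
  | neg x _ hx =>
    obtain ⟨s, hs⟩ := hx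
    refine ⟨-s, ?_⟩
    convert hs.neg using 1
    simp only [map_neg]; ring
  | mul x y _ _ hx hy =>
    obtain ⟨s, hs⟩ := hx
    obtain ⟨t, ht⟩ := hy
    refine ⟨s * t, ?_⟩
    have := (Commute.all _ _).isNilpotent_add
      ((Commute.all _ (φ (C y))).isNilpotent_mul_right hs)
      ((Commute.all _ (C s)).isNilpotent_mul_right ht)
    convert this using 1
    simp only [map_mul]; ring

theorem exists_isNilpotent_sub_aeval (hR : GeneratedByUnitsAndIdempotents R)
    (φ : MvPolynomial (Fin n) R ≃+* MvPolynomial (Fin n) S) (p : MvPolynomial (Fin n) S) :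
    ∃ t, IsNilpotent (p - aeval (R := S) (fun i => φ (X i)) t) := by
  obtain ⟨q, rfl⟩ := φ.surjective p
  induction q using MvPolynomial.induction_on with
  | C a =>
    obtain ⟨s, hs⟩ := exists_isNilpotent_sub_C hR φ a
    exact ⟨C s, by simpa [MvPolynomial.algebraMap_eq] using hs⟩
  | add p q hp hq =>
    obtain ⟨s, hs⟩ := hp
    obtain ⟨t, ht⟩ := hq
    refine ⟨s + t, ?_⟩
    convert (Commute.all _ _).isNilpotent_add hs ht using 1
    simp only [map_add]; ring
  | mul_X p i hp =>
    obtain ⟨s, hs⟩ := hp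
    refine ⟨s * X i, ?_⟩
    convert (Commute.all _ (φ (X i))).isNilpotent_mul_right hs using 1
    simp only [map_mul, aeval_X]; ring

/-- Nakayama for a nilpotent ideal: substituting `N = f(M) + I N` into itself gives `N = f(M) + I ^
k N`, with no finiteness required of `N`. -/
theorem LinearMap.range_eq_top_of_sup_smul_top {M N : Type*} [AddCommGroup M] [Module S M]
    [AddCommGroup N] [Module S N]
    (f : M →ₗ[S] N) {I : Ideal S} (hI : IsNilpotent I)
    (h : LinearMap.range f ⊔ I • (⊤ : Submodule S N) = ⊤) : LinearMap.range f = ⊤ := by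
  have key : ∀ k : ℕ, LinearMap.range f ⊔ I ^ k • (⊤ : Submodule S N) = ⊤ := by
    intro k
    induction k with
    | zero => simp
    | succ k ih =>
      have hk : I ^ k • (⊤ : Submodule S N) ≤ LinearMap.range f ⊔ I ^ (k + 1) • ⊤ := by
        have := congrArg (fun Q => I ^ k • Q) h
        simp only [Submodule.smul_sup] at this
        rw [← this, pow_succ, mul_smul]
        exact sup_le_sup_right Submodule.smul_le_right _
      exact top_le_iff.1 (ih.ge.trans (sup_le le_sup_left hk))
  obtain ⟨k, hk⟩ := hI
  simpa [hk] using key k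

/-- The nilradical need not be nilpotent, but only the finitely many coefficients of the `n` error
terms matter; they generate a nilpotent ideal `I`, and Nakayama applies to `I`. -/
theorem surjective_aeval_of_isNilpotent_sub (y : Fin n → MvPolynomial (Fin n) S)
    (h : ∀ i, ∃ t, IsNilpotent (X i - aeval (R := S) y t)) :
    Function.Surjective (aeval (R := S) y) := by
  choose t ht using h
  let I : Ideal S := ⨆ i, Ideal.span ((X i - aeval (R := S) y (t i)).coeffs : Set S)
  have hfg : I.FG := Submodule.fg_iSup _ fun i => ⟨_, rfl⟩
  have hle : I ≤ nilradical S := by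
    refine iSup_le fun i => Ideal.span_le.2 fun a ha => ?_
    obtain ⟨m, _, rfl⟩ := MvPolynomial.mem_coeffs_iff.1 ha
    exact MvPolynomial.isNilpotent_iff.1 (ht i) m
  have hI : IsNilpotent I := (Ideal.FG.isNilpotent_iff_le_nilradical hfg).2 hle
  have hX : ∀ i, X i - aeval (R := S) y (t i) ∈ Ideal.map (C (σ := Fin n)) I := by
    intro i
    rw [MvPolynomial.mem_map_C_iff]
    intro m
    by_cases hm : coeff m (X i - aeval (R := S) y (t i)) = 0
    · rw [hm]; exact zero_mem _
    · exact Ideal.mem_iSup_of_mem i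
        (Ideal.subset_span (MvPolynomial.coeff_mem_coeffs m hm))
  have hsurj : ∀ p, ∃ q, p - aeval (R := S) y q ∈ Ideal.map (C (σ := Fin n)) I := by
    intro p
    induction p using MvPolynomial.induction_on with
    | C a => exact ⟨C a, by simp [MvPolynomial.algebraMap_eq]⟩
    | add p q hp hq =>
      obtain ⟨a, ha⟩ := hp
      obtain ⟨b, hb⟩ := hq
      refine ⟨a + b, ?_⟩
      convert add_mem ha hb using 1
      simp only [map_add]; ring
    | mul_X p i hp =>
      obtain ⟨a, ha⟩ := hp
      refine ⟨a * t i, ?_⟩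
      convert add_mem (Ideal.mul_mem_left _ (X i) ha)
        (Ideal.mul_mem_left _ (aeval (R := S) y a) (hX i)) using 1
      simp only [map_mul]; ring
  have := LinearMap.range_eq_top_of_sup_smul_top (aeval (R := S) y).toLinearMap hI (by
    rw [eq_top_iff]
    intro p _
    obtain ⟨q, hq⟩ := hsurj p
    refine Submodule.mem_sup.2 ⟨aeval (R := S) y q, ⟨q, rfl⟩, p - aeval (R := S) y q, ?_,
      by ring⟩
    rw [Ideal.smul_top_eq_map]
    exact hq)
  exact LinearMap.range_eq_top.1 this

/-- The kernels of the powers of `f` stabilize at some `k`; an element of `ker f` has the form `(f ^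
k) w`, so `w` lies in `ker (f ^ (k + 1)) = ker (f ^ k)`. -/
theorem IsNoetherianRing.injective_of_surjective [IsNoetherianRing R] (f : R →+* R)
    (hf : Function.Surjective f) : Function.Injective f := by
  obtain ⟨k, hk⟩ := monotone_stabilizes_iff_noetherian.2 ‹IsNoetherianRing R›
    ⟨fun k => RingHom.ker (f ^ k), monotone_nat_of_le_succ fun k x hx => by
      rw [RingHom.mem_ker] at hx ⊢
      rw [pow_succ', RingHom.mul_def, RingHom.comp_apply, hx, map_zero]⟩
  have hsurj : Function.Surjective (f ^ k) := by
    rw [RingHom.coe_pow]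
    exact hf.iterate k
  rw [injective_iff_map_eq_zero]
  intro x hx
  obtain ⟨w, rfl⟩ := hsurj x
  have h1 : w ∈ RingHom.ker (f ^ (k + 1)) := by
    rw [RingHom.mem_ker, pow_succ', RingHom.mul_def, RingHom.comp_apply, hx]
  have h2 : RingHom.ker (f ^ k) = RingHom.ker (f ^ (k + 1)) := hk (k + 1) (Nat.le_succ k)
  rw [← h2] at h1
  exact h1

/-- Reduction to the Noetherian case: `p`, the `y i` and preimages `g i` of the variables are
defined over a finitely generated subring `S₀`. Including the `g i` keeps the map surjective over
`S₀`. -/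
theorem MvPolynomial.injective_aeval_of_surjective (y : Fin n → MvPolynomial (Fin n) S)
    (h : Function.Surjective (aeval (R := S) y)) : Function.Injective (aeval (R := S) y) := by
  classical
  rw [injective_iff_map_eq_zero]
  intro p hp
  choose g hg using fun i => h (X i)
  let T : Finset S := p.coeffs ∪
    (Finset.univ.biUnion fun i => (y i).coeffs) ∪ (Finset.univ.biUnion fun i => (g i).coeffs)
  let S₀ : Subring S := Subring.closure (T : Set S)
  have : IsNoetherianRing S₀ := is_noetherian_subring_closure _ T.finite_toSet
  let j : S₀ →+* S := S₀.subtype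
  have hj : Function.Injective (MvPolynomial.map (σ := Fin n) j) :=
    MvPolynomial.map_injective j Subtype.val_injective
  have lift : ∀ q : MvPolynomial (Fin n) S, (q.coeffs ⊆ T) →
      ∃ q₀ : MvPolynomial (Fin n) S₀, MvPolynomial.map j q₀ = q := by
    intro q hq
    have : q ∈ Set.range (MvPolynomial.map (σ := Fin n) j) := by
      rw [MvPolynomial.mem_range_map_iff_coeffs_subset]
      intro a ha
      exact ⟨⟨a, Subring.subset_closure (hq ha)⟩, rfl⟩
    exact this
  obtain ⟨p₀, hp₀⟩ := lift p (fun a ha => by simp [T, ha])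
  choose y₀ hy₀ using fun i => lift (y i) (fun a ha => by
    simp only [T, Finset.mem_union, Finset.mem_biUnion]; exact Or.inl (Or.inr ⟨i, by simp, ha⟩))
  choose g₀ hg₀ using fun i => lift (g i) (fun a ha => by
    simp only [T, Finset.mem_union, Finset.mem_biUnion]; exact Or.inr ⟨i, by simp, ha⟩)
  have comm : ∀ q, MvPolynomial.map j (aeval (R := S₀) y₀ q) =
      aeval (R := S) y (MvPolynomial.map j q) := by
    intro q
    induction q using MvPolynomial.induction_on with
    | C a => simp [MvPolynomial.algebraMap_eq]
    | add p q hp hq => simp only [map_add, hp, hq]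
    | mul_X p i hp => simp only [map_mul, hp, aeval_X, map_X, hy₀]
  have hsurj : Function.Surjective (aeval (R := S₀) y₀) := by
    rw [← AlgHom.range_eq_top, eq_top_iff, ← MvPolynomial.adjoin_range_X, Algebra.adjoin_le_iff]
    rintro _ ⟨i, rfl⟩
    refine ⟨g₀ i, hj ?_⟩
    rw [AlgHom.toRingHom_eq_coe, RingHom.coe_coe, comm, hg₀, hg, map_X]
  have hinj := IsNoetherianRing.injective_of_surjective (aeval (R := S₀) y₀).toRingHom hsurj
  rw [← hp₀, ← comm, map_eq_zero_iff _ hj] at hp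
  rw [← hp₀, (injective_iff_map_eq_zero _).1 hinj p₀ hp, map_zero]

theorem bijective_aeval_of_ringEquiv (hR : GeneratedByUnitsAndIdempotents R)
    (φ : MvPolynomial (Fin n) R ≃+* MvPolynomial (Fin n) S) :
    Function.Bijective (aeval (R := S) fun i => φ (X i)) :=
  have h := surjective_aeval_of_isNilpotent_sub _
    fun i => exists_isNilpotent_sub_aeval hR φ (X i)
  ⟨MvPolynomial.injective_aeval_of_surjective _ h, h⟩

/-- If `y` is a coordinate system of `S[X₁, …, Xₙ]`, there is an augmentation whose kernel is
generated by `y`. -/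
theorem exists_augmentation_of_bijective (y : Fin n → MvPolynomial (Fin n) S)
    (h : Function.Bijective (aeval (R := S) y)) :
    ∃ ε : MvPolynomial (Fin n) S →ₐ[S] S, (∀ i, ε (y i) = 0) ∧
      ∀ p, p - C (ε p) ∈ Ideal.span (Set.range y) := by
  let e := AlgEquiv.ofBijective (aeval (R := S) y) h
  have he : ∀ q, e q = aeval (R := S) y q := fun q => rfl
  -- The augmentation is evaluation at the origin in the coordinates `y`.
  refine ⟨(aeval (R := S) (0 : Fin n → S)).comp e.symm.toAlgHom, fun i => ?_, fun p => ?_⟩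
  · have : e.symm (y i) = X i := by rw [AlgEquiv.symm_apply_eq, he, aeval_X]
    simp [this]
  · obtain ⟨q, rfl⟩ := h.2 p
    have hq : e.symm (aeval (R := S) y q) = q := e.symm_apply_apply q
    change _ - C (aeval (R := S) (0 : Fin n → S) (e.symm (aeval (R := S) y q))) ∈ _
    rw [hq]
    clear hq
    induction q using MvPolynomial.induction_on with
    | C a => simp [MvPolynomial.algebraMap_eq]
    | add p q hp hq =>
      convert add_mem hp hq using 1
      simp only [map_add]; ring
    | mul_X p i hp =>
      simp only [map_mul, aeval_X, Pi.zero_apply, mul_zero, map_zero, sub_zero]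
      exact Ideal.mul_mem_left _ _ (Ideal.subset_span ⟨i, rfl⟩)

end Commutative

/-! ### The center of a polynomial extension, and augmentations over a noncommutative base. -/

section Center

variable {A : Type u} [Ring A] {n : ℕ}

/-- The inclusion of the polynomial ring over the center into the polynomial extension. -/
noncomputable def centerPoly (A : Type u) [Ring A] (n : ℕ) :
    MvPolynomial (Fin n) (Subring.center A) →+* PolyExt A n :=
  AddMonoidAlgebra.mapRingHom (Fin n →₀ ℕ) (Subring.center A).subtype

theorem centerPoly_monomial (m : Fin n →₀ ℕ) (z : Subring.center A) :
    centerPoly A n (monomial m z) = AddMonoidAlgebra.single m (z : A) :=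
  AddMonoidAlgebra.mapRingHom_single _ _ _

theorem coeff_centerPoly (p : MvPolynomial (Fin n) (Subring.center A)) (m : Fin n →₀ ℕ) :
    (centerPoly A n p).coeff m = (MvPolynomial.coeff m p).val :=
  rfl

theorem centerPoly_injective : Function.Injective (centerPoly A n) := by
  intro p q h
  ext m
  rw [← coeff_centerPoly, ← coeff_centerPoly, h]

theorem centerPoly_mem_center (p : MvPolynomial (Fin n) (Subring.center A)) :
    centerPoly A n p ∈ Subring.center (PolyExt A n) := by
  induction p using MvPolynomial.induction_on' with
  | monomial m z =>
    rw [centerPoly_monomial, Subring.mem_center_iff]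
    intro x
    induction x using AddMonoidAlgebra.induction_linear with
    | zero => simp
    | add x y hx hy => rw [add_mul, mul_add, hx, hy]
    | single l a =>
      rw [AddMonoidAlgebra.single_mul_single, AddMonoidAlgebra.single_mul_single, add_comm,
        Subring.mem_center_iff.1 z.2 a]
  | add p q hp hq => rw [map_add]; exact add_mem hp hq

theorem exists_centerPoly_eq {x : PolyExt A n} (hx : x ∈ Subring.center (PolyExt A n)) :
    ∃ p, centerPoly A n p = x := by
  -- Commuting with the constants already forces every coefficient to be central.
  have hc : ∀ m, x.coeff m ∈ Subring.center A := fun m => by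
    rw [Subring.mem_center_iff] at hx ⊢
    intro a
    have := congrArg (fun y => y.coeff m) (hx (AddMonoidAlgebra.single 0 a))
    simpa [AddMonoidAlgebra.coeff_mul_single_zero, AddMonoidAlgebra.coeff_single_zero_mul]
      using this
  clear hx
  change x ∈ (centerPoly A n).range
  induction x using AddMonoidAlgebra.induction with
  | zero => exact zero_mem _
  | single_add m a x hm ha ih =>
    have hxm : x.coeff m = 0 := Finsupp.notMem_support_iff.1 hm
    have h1 : a ∈ Subring.center A := by simpa [hxm] using hc m
    refine add_mem ⟨monomial m ⟨a, h1⟩, centerPoly_monomial _ _⟩ (ih fun l => ?_)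
    by_cases hl : l = m
    · rw [hl, hxm]; exact zero_mem _
    · simpa [Finsupp.single_apply, Ne.symm hl] using hc l

/-- The center of `A[t₁, …, tₙ]` is the polynomial ring over the center of `A`. -/
noncomputable def centerPolyEquiv (A : Type u) [Ring A] (n : ℕ) :
    MvPolynomial (Fin n) (Subring.center A) ≃+* Subring.center (PolyExt A n) :=
  RingEquiv.ofBijective ((centerPoly A n).codRestrict _ centerPoly_mem_center)
    ⟨fun _ _ h => centerPoly_injective (congrArg Subtype.val h), fun ⟨_, hx⟩ =>
      (exists_centerPoly_eq hx).imp fun _ h => Subtype.ext h⟩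

theorem coe_centerPolyEquiv (p : MvPolynomial (Fin n) (Subring.center A)) :
    (centerPolyEquiv A n p : PolyExt A n) = centerPoly A n p :=
  rfl

/-- The augmentation `ε` over the center extends `A`-linearly; the extension is multiplicative
because the values of `ε` are central in `A`. -/
theorem exists_algHom_of_bijective (k : Type v) [Field k] [Algebra k A]
    (y : Fin n → MvPolynomial (Fin n) (Subring.center A))
    (h : Function.Bijective (aeval (R := Subring.center A) y)) :
    ∃ ρ : PolyExt A n →ₐ[k] A, (∀ a, ρ (AddMonoidAlgebra.single 0 a) = a) ∧
      (∀ i, ρ (centerPoly A n (y i)) = 0) ∧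
      ∀ x, x - AddMonoidAlgebra.single 0 (ρ x) ∈
        Ideal.span (Set.range fun i => centerPoly A n (y i)) := by
  obtain ⟨ε, hε, hspan⟩ := exists_augmentation_of_bijective y h
  let g : Multiplicative (Fin n →₀ ℕ) →* A :=
    ((Subring.center A).subtype : Subring.center A →* A).comp
      ((ε : MvPolynomial (Fin n) (Subring.center A) →* Subring.center A).comp
        (AddMonoidAlgebra.of (Subring.center A) (Fin n →₀ ℕ)))
  let ρ : PolyExt A n →ₐ[k] A := AddMonoidAlgebra.liftNCAlgHom (AlgHom.id k A) g
    fun a m => Subring.mem_center_iff.1 (ε (monomial m.toAdd 1)).2 a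
  have hρ : ∀ m a, ρ (AddMonoidAlgebra.single m a) = a * ε (monomial m 1) := fun m a =>
    AddMonoidAlgebra.liftNC_single _ _ _ _
  have hρC : ∀ p, ρ (centerPoly A n p) = ε p := by
    intro p
    induction p using MvPolynomial.induction_on' with
    | monomial m z =>
      have hz : monomial m z = z • monomial m (1 : Subring.center A) := by
        rw [smul_monomial, smul_eq_mul, mul_one]
      rw [centerPoly_monomial, hρ, hz, map_smul]
      rfl
    | add p q hp hq => simp only [map_add, hp, hq, Subring.coe_add]
  refine ⟨ρ, fun a => ?_, fun i => ?_, fun x => ?_⟩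
  · rw [hρ, ← MvPolynomial.C_apply, map_one, map_one]; simp
  · rw [hρC, hε]; rfl
  · induction x using AddMonoidAlgebra.induction_linear with
    | zero => simp
    | add x z hx hz =>
      convert add_mem hx hz using 1
      rw [map_add, AddMonoidAlgebra.single_add]; abel
    | single m a =>
      have hm : centerPoly A n (monomial m 1 - C (ε (monomial m 1))) ∈
          Ideal.span (Set.range fun i => centerPoly A n (y i)) := by
        have := Ideal.mem_map_of_mem (centerPoly A n) (hspan (monomial m 1))
        rwa [Ideal.map_span, ← Set.range_comp] at this
      convert Ideal.mul_mem_left _ (AddMonoidAlgebra.single 0 a) hm using 1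
      rw [map_sub, MvPolynomial.C_apply, centerPoly_monomial, centerPoly_monomial, mul_sub,
        AddMonoidAlgebra.single_mul_single, AddMonoidAlgebra.single_mul_single, hρ]
      simp

end Center

/-! ### Fully faithful functors with the same essential image. -/

section EssentialImage

/-- Both sources are equivalent to the common essential image. The compatibility isomorphism is
retained because linearity of `e` is later deduced from it. -/
theorem CategoryTheory.Functor.exists_equivalence_of_essImage_eq {C D E : Type*} [Category* C]
    [Category* D] [Category* E] (G : C ⥤ E) (H : D ⥤ E) [G.Full] [G.Faithful] [H.Full]
    [H.Faithful] (h : G.essImage = H.essImage) :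
    ∃ e : C ≌ D, Nonempty (e.functor ⋙ H ≅ G) :=
  ⟨G.toEssImage.asEquivalence.trans
      ((ObjectProperty.fullSubcategoryCongr h).trans H.toEssImage.asEquivalence.symm),
    ⟨(Functor.isoWhiskerLeft (G.toEssImage ⋙ ObjectProperty.ιOfLE h.le)
      (Functor.isoWhiskerRight H.toEssImage.asEquivalence.counitIso H.essImage.ι) :
        (G.toEssImage ⋙ ObjectProperty.ιOfLE h.le) ⋙
          (H.toEssImage.asEquivalence.inverse ⋙ H.toEssImage) ⋙ H.essImage.ι ≅
          (G.toEssImage ⋙ ObjectProperty.ιOfLE h.le) ⋙ 𝟭 _ ⋙ H.essImage.ι)⟩⟩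

theorem CategoryTheory.linear_of_comp_faithful (k : Type*) [Semiring k] {C D E : Type*}
    [Category* C] [Category* D] [Category* E] [Preadditive C] [Preadditive D] [Preadditive E]
    [Linear k C] [Linear k D] [Linear k E] (F : C ⥤ D) (H : D ⥤ E)
    [H.Faithful] [H.Linear k] [(F ⋙ H).Linear k] : F.Linear k where
  map_smul f r := H.map_injective <| by
    rw [H.map_smul]
    exact (F ⋙ H).map_smul r f

end EssentialImage

/-! ### Modules over a quotient ring as modules killed by generators of the kernel. -/

section RestrictScalars

variable {R P : Type u} [Ring R] [Ring P]

theorem ModuleCat.full_restrictScalars_of_surjective (π : R →+* P) (hπ : Function.Surjective π) :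
    (ModuleCat.restrictScalars.{u} π).Full where
  map_surjective {M N} f := by
    refine ⟨ModuleCat.ofHom
      { toFun := fun m => f.hom m
        map_add' := fun a b => f.hom.map_add a b
        map_smul' := fun p m => ?_ }, rfl⟩
    obtain ⟨r, rfl⟩ := hπ p
    exact f.hom.map_smul r m

theorem ModuleCat.essImage_restrictScalars_iff (π : R →+* P) (hπ : Function.Surjective π)
    {ι : Type*} (z : ι → R) (hz : ∀ i, π (z i) = 0)
    (hker : ∀ x, π x = 0 → x ∈ Ideal.span (Set.range z)) (M : ModuleCat.{u} R) :
    (ModuleCat.restrictScalars.{u} π).essImage M ↔ ∀ i, ∀ m : M, z i • m = 0 := by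
  constructor
  · rintro ⟨X, ⟨e⟩⟩ i m
    obtain ⟨x, rfl⟩ := e.toLinearEquiv.surjective m
    rw [← map_smul]
    have : z i • x = 0 := by
      change π (z i) • (show X from x) = 0
      rw [hz, zero_smul]
    rw [this, map_zero]
  · intro h
    have hkill : ∀ x, π x = 0 → ∀ m : M, x • m = 0 := by
      intro x hx m
      have : Ideal.span (Set.range z) ≤ LinearMap.ker (LinearMap.toSpanSingleton R M m) := by
        refine Ideal.span_le.2 ?_
        rintro _ ⟨i, rfl⟩
        exact h i m
      exact this (hker x hx)
    have hcongr : ∀ x y, π x = π y → ∀ m : M, x • m = y • m := by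
      intro x y hxy m
      rw [← sub_eq_zero, ← sub_smul]
      exact hkill _ (by rw [map_sub, hxy, sub_self]) m
    -- A merely set-theoretic section suffices: by `hcongr` the action does not depend on the chosen
    -- lift.
    let s : P → R := Function.surjInv hπ
    have hs : ∀ p, π (s p) = p := Function.surjInv_eq hπ
    let : Module P M :=
      { smul := fun p m => s p • m
        one_smul := fun m => (hcongr _ 1 (by rw [hs, map_one]) m).trans (one_smul R m)
        mul_smul := fun p q m =>
          (hcongr _ (s p * s q) (by rw [hs, map_mul, hs, hs]) m).trans (mul_smul _ _ m)
        smul_zero := fun p => smul_zero (s p)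
        smul_add := fun p => smul_add (s p)
        add_smul := fun p q m =>
          (hcongr _ (s p + s q) (by rw [hs, map_add, hs, hs]) m).trans (add_smul _ _ m)
        zero_smul := fun m => (hcongr _ 0 (by rw [hs, map_zero]) m).trans (zero_smul R m) }
    have hsmul : ∀ (r : R) (m : M), π r • m = r • m := fun r m => hcongr _ r (hs _) m
    let e : (ModuleCat.restrictScalars.{u} π).obj (ModuleCat.of P M) ≃ₗ[R] M :=
      { toFun := fun m => m
        invFun := fun m => m
        map_add' := fun _ _ => rfl
        map_smul' := hsmul
        left_inv := fun _ => rfl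
        right_inv := fun _ => rfl }
    exact ⟨ModuleCat.of P M, ⟨e.toModuleIso⟩⟩

/-- An equivalence of module categories that identifies the modules killed by `z` with the modules
killed by `w` descends to the module categories of the quotient rings. -/
theorem ModuleCat.exists_equivalence_of_surjective {S Q : Type u} [Ring S] [Ring Q]
    (F : ModuleCat.{u} R ≌ ModuleCat.{u} S) (π : R →+* P) (hπ : Function.Surjective π)
    (τ : S →+* Q) (hτ : Function.Surjective τ) {ι : Type*} (z : ι → R) (w : ι → S)
    (hz : ∀ i, π (z i) = 0) (hzker : ∀ x, π x = 0 → x ∈ Ideal.span (Set.range z))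
    (hw : ∀ i, τ (w i) = 0) (hwker : ∀ x, τ x = 0 → x ∈ Ideal.span (Set.range w))
    (hF : ∀ i (M : ModuleCat.{u} R),
      (∀ m : M, z i • m = 0) ↔ ∀ m : F.functor.obj M, w i • m = 0) :
    ∃ e : ModuleCat.{u} P ≌ ModuleCat.{u} Q,
      Nonempty (e.functor ⋙ ModuleCat.restrictScalars.{u} τ ≅
        ModuleCat.restrictScalars.{u} π ⋙ F.functor) := by
  have := ModuleCat.full_restrictScalars_of_surjective π hπ
  have := ModuleCat.full_restrictScalars_of_surjective τ hτ
  refine Functor.exists_equivalence_of_essImage_eq _ _ ?_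
  ext N
  rw [ModuleCat.essImage_restrictScalars_iff τ hτ w hw hwker]
  constructor
  · rintro ⟨X, ⟨e⟩⟩ i n
    obtain ⟨x, rfl⟩ := e.toLinearEquiv.surjective n
    rw [← map_smul]
    have := (hF i _).1 (fun m => (ModuleCat.essImage_restrictScalars_iff π hπ z hz hzker _).1
      (Functor.obj_mem_essImage _ X) i m) x
    exact (congrArg _ this).trans (map_zero _)
  · intro h
    have hM : (ModuleCat.restrictScalars.{u} π).essImage (F.inverse.obj N) := by
      rw [ModuleCat.essImage_restrictScalars_iff π hπ z hz hzker]
      intro i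
      rw [hF]
      intro m
      let e := (F.counitIso.app N).toLinearEquiv
      apply e.injective
      exact (map_smul e (w i) m).trans ((h i _).trans (map_zero e).symm)
    obtain ⟨X, ⟨e⟩⟩ := hM
    exact ⟨X, ⟨F.functor.mapIso e ≪≫ F.counitIso.app N⟩⟩

end RestrictScalars

/-! ### The center of a ring as the natural endomorphisms of the identity functor on modules. -/

section CategoryCenter

variable {R S : Type u} [Ring R] [Ring S]

/-- The action of a central element on a module, as a morphism. -/
def ModuleCat.centralEnd (z : Subring.center R) (M : ModuleCat.{u} R) : M ⟶ M :=
  ModuleCat.ofHom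
    { toFun := fun m => (z : R) • m
      map_add' := smul_add _
      map_smul' := fun r m => by
        rw [RingHom.id_apply, ← mul_smul, ← mul_smul, Subring.mem_center_iff.1 z.2 r] }

namespace ModuleCat

@[simp]
theorem centralEnd_apply (z : Subring.center R) (M : ModuleCat.{u} R) (m : M) :
    (centralEnd z M).hom m = (z : R) • m :=
  rfl

theorem centralEnd_naturality (z : Subring.center R) {M N : ModuleCat.{u} R} (f : M ⟶ N) :
    centralEnd z M ≫ f = f ≫ centralEnd z N := by
  ext m
  exact map_smul f.hom (z : R) m

theorem centralEnd_injective {z z' : Subring.center R}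
    (h : centralEnd z (ModuleCat.of R R) = centralEnd z' (ModuleCat.of R R)) : z = z' := by
  have : (z : R) • (1 : R) = (z' : R) • (1 : R) := congrArg (fun f => f.hom (1 : R)) h
  exact Subtype.ext (by simpa using this)

/-- Naturality along the maps `R → M`, `1 ↦ m`, shows that `θ` is multiplication by its value at `1
: R`; linearity of `θ` on `R` makes that value central. -/
theorem exists_centralEnd_eq (θ : ∀ M : ModuleCat.{u} R, M ⟶ M)
    (hθ : ∀ {M N : ModuleCat.{u} R} (f : M ⟶ N), θ M ≫ f = f ≫ θ N) :
    ∃ z : Subring.center R, ∀ M, θ M = centralEnd z M := by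
  let e (M : ModuleCat.{u} R) (m : M) : ModuleCat.of R R ⟶ M :=
    ModuleCat.ofHom (LinearMap.toSpanSingleton R M m)
  have he : ∀ (M : ModuleCat.{u} R) (m : M) (r : R), (e M m).hom r = r • m := fun _ _ _ => rfl
  let c : R := (θ (ModuleCat.of R R)).hom (1 : R)
  have key : ∀ (M : ModuleCat.{u} R) (m : M), (θ M).hom m = c • m := by
    intro M m
    have h := congrArg (fun f => f.hom (1 : R)) (hθ (e M m))
    simp only [ModuleCat.hom_comp, LinearMap.comp_apply] at h
    rw [he, he, one_smul] at h
    exact h.symm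
  have hc : c ∈ Subring.center R := by
    rw [Subring.mem_center_iff]
    intro r
    have h1 : (θ (ModuleCat.of R R)).hom r = c * r := key (ModuleCat.of R R) r
    have h2 := (θ (ModuleCat.of R R)).hom.map_smul r (1 : R)
    simp only [smul_eq_mul, mul_one] at h2
    exact h2.symm.trans h1
  exact ⟨⟨c, hc⟩, fun M => by ext m; exact key M m⟩

variable (F : ModuleCat.{u} R ≌ ModuleCat.{u} S)

theorem exists_map_centralEnd_eq (w : Subring.center S) :
    ∃ z : Subring.center R, ∀ M, F.functor.map (centralEnd z M) =
      centralEnd w (F.functor.obj M) := by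
  obtain ⟨z, hz⟩ := exists_centralEnd_eq
    (fun M => F.functor.preimage (centralEnd w (F.functor.obj M))) (fun f =>
      F.functor.map_injective (by simp [centralEnd_naturality]))
  exact ⟨z, fun M => by rw [← hz, F.functor.map_preimage]⟩

theorem exists_centralEnd_eq_map (z : Subring.center R) :
    ∃ w : Subring.center S, ∀ M, F.functor.map (centralEnd z M) =
      centralEnd w (F.functor.obj M) := by
  -- Lifting `z` through the inverse equivalence gives `w`; the unit, being natural, then transports
  -- the identity back to `M`.
  obtain ⟨w, hw⟩ := exists_map_centralEnd_eq F.symm z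
  refine ⟨w, fun M => F.inverse.map_injective ?_⟩
  rw [← cancel_epi (F.unit.app M)]
  refine (F.unit.naturality (centralEnd z M)).symm.trans ?_
  refine (centralEnd_naturality z (F.unit.app M)).trans ?_
  exact congrArg _ (hw (F.functor.obj M)).symm

/-- The regular module is isomorphic to an object in the image of `F`, and it detects central
elements. -/
theorem eq_of_centralEnd_map_eq {w w' : Subring.center S}
    (h : ∀ M, centralEnd w (F.functor.obj M) = centralEnd w' (F.functor.obj M)) : w = w' := by
  apply centralEnd_injective
  let e : F.functor.obj (F.inverse.obj (ModuleCat.of S S)) ≅ ModuleCat.of S S :=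
    F.counitIso.app (ModuleCat.of S S)
  rw [← cancel_epi e.hom, ← centralEnd_naturality, ← centralEnd_naturality]
  exact congrArg (· ≫ e.hom) (h _)

/-- An equivalence of module categories induces an isomorphism of centers. -/
theorem exists_centerEquiv :
    ∃ ω : Subring.center R ≃+* Subring.center S, ∀ z M,
      F.functor.map (centralEnd z M) = centralEnd (ω z) (F.functor.obj M) := by
  have : F.functor.Additive := F.functor.additive_of_preserves_binary_products
  choose ω hω using exists_centralEnd_eq_map F
  let f : Subring.center R →+* Subring.center S :=
    { toFun := ω
      map_one' := eq_of_centralEnd_map_eq F fun M => by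
        rw [← hω, show centralEnd 1 M = 𝟙 M by ext m; exact one_smul R m, F.functor.map_id]
        ext m; exact (one_smul S m).symm
      map_mul' := fun a b => eq_of_centralEnd_map_eq F fun M => by
        rw [← hω, show centralEnd (a * b) M = centralEnd b M ≫ centralEnd a M by
          ext m; exact mul_smul (a : R) (b : R) m, F.functor.map_comp, hω, hω]
        ext m; exact (mul_smul (ω a : S) (ω b : S) m).symm
      map_zero' := eq_of_centralEnd_map_eq F fun M => by
        rw [← hω, show centralEnd 0 M = 0 by ext m; exact zero_smul R m, F.functor.map_zero]
        ext m; exact (zero_smul S m).symm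
      map_add' := fun a b => eq_of_centralEnd_map_eq F fun M => by
        rw [← hω, show centralEnd (a + b) M = centralEnd a M + centralEnd b M by
          ext m; exact add_smul (a : R) (b : R) m, F.functor.map_add, hω, hω]
        ext m; exact (add_smul (ω a : S) (ω b : S) m).symm }
  refine ⟨RingEquiv.ofBijective f ⟨fun a b hab => ?_, fun w => ?_⟩, hω⟩
  · apply centralEnd_injective
    apply F.functor.map_injective
    rw [hω, hω]
    exact congrArg (fun c => centralEnd c _) hab
  · obtain ⟨z, hz⟩ := exists_map_centralEnd_eq F w
    exact ⟨z, eq_of_centralEnd_map_eq F fun M => by rw [← hz]; exact (hω z M).symm⟩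

theorem smul_eq_zero_iff_of_map_centralEnd {z : Subring.center R} {w : Subring.center S}
    {M : ModuleCat.{u} R}
    (h : F.functor.map (centralEnd z M) = centralEnd w (F.functor.obj M)) :
    (∀ m : M, (z : R) • m = 0) ↔ ∀ m : F.functor.obj M, (w : S) • m = 0 := by
  have : F.functor.Additive := F.functor.additive_of_preserves_binary_products
  have h0 {T : Type u} [Ring T] (t : Subring.center T) (N : ModuleCat.{u} T) :
      (∀ m : N, (t : T) • m = 0) ↔ centralEnd t N = 0 :=
    ⟨fun H => by ext m; exact H m, fun H m => by rw [← centralEnd_apply, H]; rfl⟩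
  rw [h0, h0, ← h, F.functor.map_eq_zero_iff]

end ModuleCat

end CategoryCenter

/-! ### The three hypotheses give generation by units and idempotents modulo nilpotents. -/

section Hypotheses

variable {R : Type*} [CommRing R]

theorem isNilpotent_of_quotient_nilradical {x : R}
    (h : Ideal.Quotient.mk (nilradical R) x = 0) : IsNilpotent x :=
  mem_nilradical.1 (Ideal.Quotient.eq_zero_iff_mem.1 h)

theorem GeneratedByUnitsAndIdempotents.of_ringEquiv {S : Type*} [CommRing S]
    (h : GeneratedByUnitsAndIdempotents R) (e : R ≃+* S) : GeneratedByUnitsAndIdempotents S := by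
  have hR : Subring.closure {x : R | IsUnit x ∨ IsNilpotent (x * x - x)} = ⊤ := h
  have hmap := congrArg (Subring.map e.toRingHom) hR
  rw [RingHom.map_closure, ← RingHom.range_eq_map,
    (RingHom.range_eq_top (f := e.toRingHom)).2 e.surjective] at hmap
  refine top_le_iff.1 (hmap.ge.trans (Subring.closure_mono ?_))
  rintro _ ⟨x, hx, rfl⟩
  rcases hx with hx | hx
  · exact Or.inl (hx.map e)
  · right
    simpa using hx.map e

/-- Any lift of a generator is again a generator, and nilpotents are themselves idempotent modulo
the nilradical, so the kernel of the quotient map causes no loss. -/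
theorem GeneratedByUnitsAndIdempotents.of_quotient_nilradical
    (h : GeneratedByUnitsAndIdempotents (R ⧸ nilradical R)) :
    GeneratedByUnitsAndIdempotents R := by
  let q := Ideal.Quotient.mk (nilradical R)
  have hker : ∀ x, q x = 0 → x ∈ Subring.closure {x : R | IsUnit x ∨ IsNilpotent (x * x - x)} := by
    intro x hx
    refine Subring.subset_closure (Or.inr ?_)
    have hn := isNilpotent_of_quotient_nilradical hx
    exact (Commute.all _ _).isNilpotent_sub ((Commute.all _ _).isNilpotent_mul_right hn) hn
  have key : ∀ y : R ⧸ nilradical R,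
      ∃ x ∈ Subring.closure {x : R | IsUnit x ∨ IsNilpotent (x * x - x)}, q x = y := by
    intro y
    have hy : y ∈ Subring.closure
        {x : R ⧸ nilradical R | IsUnit x ∨ IsNilpotent (x * x - x)} := by
      rw [show Subring.closure _ = ⊤ from h]; trivial
    have hle : Subring.closure {x : R ⧸ nilradical R | IsUnit x ∨ IsNilpotent (x * x - x)} ≤
        (Subring.closure {x : R | IsUnit x ∨ IsNilpotent (x * x - x)}).map q := by
      rw [Subring.closure_le]
      intro y hy
      obtain ⟨x, rfl⟩ := Ideal.Quotient.mk_surjective y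
      refine ⟨x, Subring.subset_closure ?_, rfl⟩
      rcases hy with hy | hy
      · left
        obtain ⟨y', hy'⟩ := isUnit_iff_exists_inv.1 hy
        obtain ⟨x', rfl⟩ := Ideal.Quotient.mk_surjective y'
        have hn : IsNilpotent (x * x' - 1) := isNilpotent_of_quotient_nilradical (by
          rw [map_sub, map_mul, hy', map_one, sub_self])
        have hu := hn.isUnit_add_one
        rw [sub_add_cancel] at hu
        exact isUnit_of_mul_isUnit_left hu
      · right
        rw [← map_mul, ← map_sub] at hy
        obtain ⟨m, hm⟩ := hy
        rw [← map_pow] at hm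
        obtain ⟨l, hl⟩ := isNilpotent_of_quotient_nilradical hm
        exact ⟨m * l, by rw [pow_mul, hl]⟩
    exact hle hy
  refine top_le_iff.1 fun x _ => ?_
  obtain ⟨x', hx', hq⟩ := key (q x)
  have := add_mem (hker (x - x') (by rw [map_sub, hq, sub_self])) hx'
  rwa [sub_add_cancel] at this

theorem GeneratedByUnits.generatedByUnitsAndIdempotents {k : Type v} [Field k] {R : Type u}
    [CommRing R] [Algebra k R] (h : GeneratedByUnits k R) :
    GeneratedByUnitsAndIdempotents R := by
  obtain ⟨S, hS, htop⟩ := h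
  refine top_le_iff.1 fun x _ => ?_
  have hx : x ∈ Algebra.adjoin k S := htop ▸ Algebra.mem_top
  induction hx using Algebra.adjoin_induction with
  | mem x hx => exact Subring.subset_closure (Or.inl (hS x hx))
  | algebraMap c =>
    by_cases hc : c = 0
    · rw [hc, map_zero]; exact zero_mem _
    · exact Subring.subset_closure (Or.inl ((IsUnit.mk0 c hc).map (algebraMap k R)))
  | add x y _ _ hx hy => exact add_mem (hx trivial) (hy trivial)
  | mul x y _ _ hx hy => exact mul_mem (hx trivial) (hy trivial)

/-- Once `c * c * x = c`, the element `c` is the idempotent `c * x` times the unit `c + (1 - c *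
x)`. -/
theorem IsVonNeumannRegular.generatedByUnitsAndIdempotents {R : Type u} [CommRing R]
    (h : IsVonNeumannRegular R) : GeneratedByUnitsAndIdempotents R := by
  obtain ⟨hred, hdim⟩ := h
  refine top_le_iff.1 fun c _ => ?_
  let M : Submonoid R :=
    { carrier := {y | ∃ (n : ℕ) (x : R), y = c ^ n * (1 - c * x)}
      one_mem' := ⟨0, 0, by simp⟩
      mul_mem' := by
        rintro _ _ ⟨n, x, rfl⟩ ⟨m, y, rfl⟩
        exact ⟨n + m, x + y - c * x * y, by ring⟩ }
  obtain ⟨x, hx⟩ : ∃ x, c * c * x = c := by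
    -- A prime avoiding `M` would be maximal and omit `c`; inverting `c` modulo it puts some `1 - c
    -- * x`, an element of `M`, into the prime.
    have h0 : (0 : R) ∈ M := by
      by_contra h0
      obtain ⟨p, hp, -, hdisj⟩ := Ideal.exists_le_prime_disjoint (⊥ : Ideal R) M
        (Set.disjoint_left.2 fun y hy hyM => h0 (by rwa [← (Ideal.mem_bot.1 hy : y = 0)]))
      have hmax : p.IsMaximal := hp.isMaximal'
      have hc : c ∉ p := fun hc => Set.disjoint_left.1 hdisj hc ⟨1, 0, by simp⟩
      obtain ⟨x, hx⟩ := hmax.exists_inv hc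
      obtain ⟨i, hi, hxi⟩ := hx
      exact Set.disjoint_left.1 hdisj hi ⟨0, x, by linear_combination hxi⟩
    obtain ⟨n, x, hn⟩ := h0
    have hnil : IsNilpotent (c * (1 - c * x)) :=
      ⟨n + 1, by rw [mul_pow]; linear_combination (-(c * (1 - c * x) ^ n)) * hn⟩
    exact ⟨x, by linear_combination -hnil.eq_zero⟩
  have he : (c * x) * (c * x) = c * x := by linear_combination x * hx
  have hu : IsUnit (c + (1 - c * x)) :=
    IsUnit.of_mul_eq_one (c * x * x + (1 - c * x)) (by
      linear_combination (2 * x - 1 - x * x) * hx)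
  have hc : c = (c * x) * (c + (1 - c * x)) := by linear_combination (x - 1) * hx
  rw [hc]
  refine mul_mem (Subring.subset_closure (Or.inr ?_)) (Subring.subset_closure (Or.inl hu))
  rw [he, sub_self]; exact IsNilpotent.zero

theorem IsFiniteSumOfLocalAlgebras.generatedByUnitsAndIdempotents {k : Type v} [Field k]
    {R : Type u} [CommRing R] [Algebra k R] (h : IsFiniteSumOfLocalAlgebras k R) :
    GeneratedByUnitsAndIdempotents R := by
  classical
  obtain ⟨m, L, _, _, hL, ⟨e⟩⟩ := h
  refine GeneratedByUnitsAndIdempotents.of_ringEquiv ?_ e.symm.toRingEquiv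
  refine top_le_iff.1 fun x _ => ?_
  -- In a local ring `t` or `1 - t` is a unit. With `b` the indicator of the non-unit components, `x
  -- = b + (1 - 2b) a`, where `a` is a unit.
  let a : ∀ i, L i := fun i => if IsUnit (x i) then x i else 1 - x i
  let b : ∀ i, L i := fun i => if IsUnit (x i) then 0 else 1
  have ha : IsUnit a := Pi.isUnit_iff.2 fun i => by
    by_cases hi : IsUnit (x i)
    · simp [a, hi]
    · have := hL i
      simpa [a, hi] using (IsLocalRing.isUnit_or_isUnit_one_sub_self (x i)).resolve_left hi
  have hb : b * b = b := by
    ext i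
    by_cases hi : IsUnit (x i) <;> simp [b, hi]
  have hx : x = b + (1 - b - b) * a := by
    ext i
    by_cases hi : IsUnit (x i) <;> simp [a, b, hi]
  have hb' : b ∈ Subring.closure {x : ∀ i, L i | IsUnit x ∨ IsNilpotent (x * x - x)} :=
    Subring.subset_closure (Or.inr (by rw [hb, sub_self]; exact IsNilpotent.zero))
  rw [hx]
  exact add_mem hb' (mul_mem (sub_mem (sub_mem (one_mem _) hb') hb')
    (Subring.subset_closure (Or.inl ha)))

end Hypotheses

/-! ### Cancellation and Morita cancellation from generation of the center. -/

section Cancellation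

variable {A B : Type u} [Ring A] [Ring B] {n : ℕ}

/-- The isomorphism of polynomial rings over the centers induced by an isomorphism of the centers
of the polynomial extensions. -/
noncomputable def polyEquivOfCenterEquiv
    (ω : Subring.center (PolyExt A n) ≃+* Subring.center (PolyExt B n)) :
    MvPolynomial (Fin n) (Subring.center A) ≃+* MvPolynomial (Fin n) (Subring.center B) :=
  ((centerPolyEquiv A n).trans ω).trans (centerPolyEquiv B n).symm

theorem centerPoly_polyEquivOfCenterEquiv
    (ω : Subring.center (PolyExt A n) ≃+* Subring.center (PolyExt B n))
    (p : MvPolynomial (Fin n) (Subring.center A)) :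
    centerPoly B n (polyEquivOfCenterEquiv ω p) = ω (centerPolyEquiv A n p) := by
  rw [← coe_centerPolyEquiv]
  simp [polyEquivOfCenterEquiv]

/-- The variables of `A[t₁, …, tₙ]`, as elements of the center. -/
noncomputable def centralVar (A : Type u) [Ring A] (n : ℕ) (i : Fin n) :
    Subring.center (PolyExt A n) :=
  centerPolyEquiv A n (X i)

variable (k : Type v) [Field k] [Algebra k B]

theorem exists_augmentation (A : Type u) [Ring A] [Algebra k A] (n : ℕ) :
    ∃ ρ : PolyExt A n →ₐ[k] A, (∀ a, ρ (AddMonoidAlgebra.single 0 a) = a) ∧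
      (∀ i, ρ (centralVar A n i) = 0) ∧
      ∀ x, x - AddMonoidAlgebra.single 0 (ρ x) ∈
        Ideal.span (Set.range fun i => (centralVar A n i : PolyExt A n)) :=
  exists_algHom_of_bijective k X (by
    rw [MvPolynomial.aeval_X_left]; exact Function.bijective_id)

theorem exists_augmentation_of_centerEquiv
    (hA : GeneratedByUnitsAndIdempotents (Subring.center A))
    (ω : Subring.center (PolyExt A n) ≃+* Subring.center (PolyExt B n)) :
    ∃ ρ : PolyExt B n →ₐ[k] B, (∀ b, ρ (AddMonoidAlgebra.single 0 b) = b) ∧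
      (∀ i, ρ (ω (centralVar A n i)) = 0) ∧
      ∀ x, x - AddMonoidAlgebra.single 0 (ρ x) ∈
        Ideal.span (Set.range fun i => (ω (centralVar A n i) : PolyExt B n)) := by
  have := exists_algHom_of_bijective k _ (bijective_aeval_of_ringEquiv hA (polyEquivOfCenterEquiv ω))
  simpa only [centerPoly_polyEquivOfCenterEquiv, centralVar] using this

theorem stronglyCancellative_of_generatedByUnitsAndIdempotents [Algebra k A]
    (hA : GeneratedByUnitsAndIdempotents (Subring.center A)) : StronglyCancellative k A := by
  rintro n - B _ _ ⟨e⟩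
  let ω := Subring.centerCongr e.toRingEquiv
  obtain ⟨ρ, hρC, hρX, hρ⟩ := exists_augmentation k A n
  obtain ⟨τ, hτC, hτX, hτ⟩ := exists_augmentation_of_centerEquiv k hA ω
  -- The two kernels are generated by corresponding central elements, so `e` descends to an
  -- isomorphism of the quotients `A` and `B`.
  have hker : ∀ x, ρ x = 0 ↔ τ (e x) = 0 := by
    intro x
    constructor
    · intro hx
      have hxs := hρ x
      rw [hx, AddMonoidAlgebra.single_zero, sub_zero] at hxs
      have hle : Ideal.span (Set.range fun i => (centralVar A n i : PolyExt A n)) ≤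
          RingHom.ker (τ.comp e.toAlgHom) := by
        rw [Ideal.span_le]
        rintro _ ⟨i, rfl⟩
        exact hτX i
      exact hle hxs
    · intro hx
      have hxs := hτ (e x)
      rw [hx, AddMonoidAlgebra.single_zero, sub_zero] at hxs
      have hle : Ideal.span (Set.range fun i => (ω (centralVar A n i) : PolyExt B n)) ≤
          RingHom.ker (ρ.comp e.symm.toAlgHom) := by
        rw [Ideal.span_le]
        rintro _ ⟨i, rfl⟩
        change ρ (e.symm (e (centralVar A n i))) = 0
        rw [e.symm_apply_apply, hρX]
      have h2 : ρ (e.symm (e x)) = 0 := hle hxs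
      rwa [e.symm_apply_apply] at h2
  let f : A →ₐ[k] B := (τ.comp e.toAlgHom).comp AddMonoidAlgebra.singleZeroAlgHom
  have hf : ∀ a, f a = τ (e (AddMonoidAlgebra.single 0 a)) := fun a => rfl
  refine ⟨AlgEquiv.ofBijective f ⟨?_, fun b => ?_⟩⟩
  · rw [injective_iff_map_eq_zero]
    intro a ha
    rw [hf, ← hker, hρC] at ha
    exact ha
  · obtain ⟨x, hx⟩ := e.surjective (AddMonoidAlgebra.single 0 b)
    refine ⟨ρ x, ?_⟩
    have h1 : ρ (x - AddMonoidAlgebra.single 0 (ρ x)) = 0 := by rw [map_sub, hρC, sub_self]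
    rw [hker, map_sub, map_sub, sub_eq_zero, hx, hτC] at h1
    rw [hf, ← h1]

/-- Passing to the opposite ring turns left ideals into right ideals; with central generators the
two coincide. -/
theorem op_mem_span_of_mem_span {R ι : Type*} [Ring R] [Fintype ι] (z : ι → Subring.center R)
    {x : R} (hx : x ∈ Ideal.span (Set.range fun i => (z i : R))) :
    MulOpposite.op x ∈ Ideal.span (Set.range fun i => MulOpposite.op (z i : R)) := by
  obtain ⟨c, rfl⟩ := Submodule.mem_span_range_iff_exists_fun R |>.1 hx
  rw [Finset.op_sum]
  refine sum_mem fun i _ => ?_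
  rw [smul_eq_mul, Subring.mem_center_iff.1 (z i).2, MulOpposite.op_mul]
  exact Ideal.mul_mem_left _ _ (Ideal.subset_span ⟨i, rfl⟩)

theorem exists_equivalence_of_polyExt [Algebra k A]
    (hA : GeneratedByUnitsAndIdempotents (Subring.center A))
    (F : RightMod (PolyExt A n) ≌ RightMod (PolyExt B n)) :
    ∃ (π : (PolyExt A n)ᵐᵒᵖ →ₐ[k] Aᵐᵒᵖ) (τ : (PolyExt B n)ᵐᵒᵖ →ₐ[k] Bᵐᵒᵖ)
      (e : RightMod A ≌ RightMod B),
      Nonempty (e.functor ⋙ ModuleCat.restrictScalars τ.toRingHom ≅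
        ModuleCat.restrictScalars π.toRingHom ⋙ F.functor) := by
  obtain ⟨ω', hω'⟩ := ModuleCat.exists_centerEquiv F
  let ω : Subring.center (PolyExt A n) ≃+* Subring.center (PolyExt B n) :=
    (Subring.centerToMulOpposite.trans ω').trans Subring.centerToMulOpposite.symm
  obtain ⟨π, hπC, hπX, hπ⟩ := exists_augmentation k A n
  obtain ⟨τ, hτC, hτX, hτ⟩ := exists_augmentation_of_centerEquiv k hA ω
  refine ⟨AlgHom.op π, AlgHom.op τ, ModuleCat.exists_equivalence_of_surjective F _ ?_ _ ?_
    (fun i => MulOpposite.op (centralVar A n i : PolyExt A n))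
    (fun i => MulOpposite.op (ω (centralVar A n i) : PolyExt B n)) ?_ ?_ ?_ ?_ ?_⟩
  · exact fun a => ⟨MulOpposite.op (AddMonoidAlgebra.single 0 a.unop),
      congrArg MulOpposite.op (hπC _)⟩
  · exact fun b => ⟨MulOpposite.op (AddMonoidAlgebra.single 0 b.unop),
      congrArg MulOpposite.op (hτC _)⟩
  · exact fun i => congrArg MulOpposite.op (hπX i)
  · intro x hx
    have hx' : π x.unop = 0 := congrArg MulOpposite.unop hx
    have := hπ x.unop
    rw [hx', AddMonoidAlgebra.single_zero, sub_zero] at this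
    exact op_mem_span_of_mem_span (centralVar A n) this
  · exact fun i => congrArg MulOpposite.op (hτX i)
  · intro x hx
    have hx' : τ x.unop = 0 := congrArg MulOpposite.unop hx
    have := hτ x.unop
    rw [hx', AddMonoidAlgebra.single_zero, sub_zero] at this
    exact op_mem_span_of_mem_span (fun i => ω (centralVar A n i)) this
  · exact fun i M => ModuleCat.smul_eq_zero_iff_of_map_centralEnd F
      (hω' (Subring.centerToMulOpposite (centralVar A n i)) M)

theorem stronglyMoritaCancellative_of_generatedByUnitsAndIdempotents [Algebra k A]
    (hA : GeneratedByUnitsAndIdempotents (Subring.center A)) :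
    StronglyMoritaCancellative k A := by
  rintro n - B _ _ ⟨F⟩
  obtain ⟨_, _, e, _⟩ := exists_equivalence_of_polyExt k hA F
  exact ⟨e⟩

theorem stronglyLinearMoritaCancellative_of_generatedByUnitsAndIdempotents [Algebra k A]
    (hA : GeneratedByUnitsAndIdempotents (Subring.center A)) :
    StronglyLinearMoritaCancellative k A := by
  rintro n - B _ _ ⟨⟨F, hF⟩⟩
  obtain ⟨π, τ, e, ⟨i⟩⟩ := exists_equivalence_of_polyExt k hA F
  -- Restriction along the algebra map `π` is `k`-linear, so the composite with `F` is; linearity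
  -- passes through `i` and descends along the faithful restriction along `τ`.
  have : (ModuleCat.restrictScalars π.toRingHom ⋙ F.functor).Linear k := inferInstance
  have : (e.functor ⋙ ModuleCat.restrictScalars τ.toRingHom).Linear k := Functor.linear_of_iso k i.symm
  exact ⟨⟨e, linear_of_comp_faithful k e.functor (ModuleCat.restrictScalars τ.toRingHom)⟩⟩

end Cancellation

theorem corollary0p6 (k : Type v) [Field k] (A : Type u) [Ring A] [Algebra k A]
    (h : GeneratedByUnits k
          (Subalgebra.center k A ⧸ nilradical (Subalgebra.center k A)) ∨
        IsVonNeumannRegular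
          (Subalgebra.center k A ⧸ nilradical (Subalgebra.center k A)) ∨
        IsFiniteSumOfLocalAlgebras k (Subalgebra.center k A)) :
    (StronglyCancellative k (Subalgebra.center k A) ∧
      StronglyMoritaCancellative k (Subalgebra.center k A) ∧
      StronglyLinearMoritaCancellative k (Subalgebra.center k A)) ∧
    (StronglyCancellative k A ∧
      StronglyMoritaCancellative k A ∧
      StronglyLinearMoritaCancellative k A) := by
  let Z := Subalgebra.center k A
  have hZ : GeneratedByUnitsAndIdempotents Z := by
    rcases h with h | h | h
    · exact .of_quotient_nilradical h.generatedByUnitsAndIdempotents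
    · exact .of_quotient_nilradical h.generatedByUnitsAndIdempotents
    · exact h.generatedByUnitsAndIdempotents
  have hA : GeneratedByUnitsAndIdempotents (Subring.center A) := hZ
  -- The general results speak of the center of the algebra; `Z` is commutative, hence its own
  -- center.
  have hZZ : GeneratedByUnitsAndIdempotents (Subring.center Z) :=
    hZ.of_ringEquiv ((Subring.topEquiv.symm).trans
      (RingEquiv.subringCongr (Subring.center_eq_top Z).symm))
  exact ⟨⟨stronglyCancellative_of_generatedByUnitsAndIdempotents k hZZ,
      stronglyMoritaCancellative_of_generatedByUnitsAndIdempotents k hZZ,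
      stronglyLinearMoritaCancellative_of_generatedByUnitsAndIdempotents k hZZ⟩,
    stronglyCancellative_of_generatedByUnitsAndIdempotents k hA,
    stronglyMoritaCancellative_of_generatedByUnitsAndIdempotents k hA,
    stronglyLinearMoritaCancellative_of_generatedByUnitsAndIdempotents k hA⟩
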